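/- Let $\Omega\subset\mathbb R^n$ be a bounded open set, let $u_a<u_b$ be real constants, and let $\epsilon>0$ and $\rho>0$ with $\rho^2\ge \frac1{u_b-u_a}$. Put $$\psi_\epsilon(t):=\sqrt{\epsilon+|t|^2}+\epsilon|t|^2\quad(t\in\mathbb R^n),\qquad {\max}_\rho(x):=\begin{cases}\max(0,x)&\text{if }|x|\ge\frac1{2\rho},\\ \frac\rho2\left(x+\frac1{2\rho}\right)^2&\text{if }|x|\le\frac1{2\rho},\end{cases}\quad(x\in\mathbb R),$$ where $|\cdot|$ is the Euclidean norm, and for $u\in H^1(\Omega)$ put $$\lambda^a_\rho(u):={\max}_\rho(\rho(u_a-u)),\qquad \lambda^b_\rho(u):={\max}_\rho(\rho(u-u_b)).$$ Let $g\in L^2(\Omega)$ and let $u\in H^1(\Omega)$ satisfy $$\int_\Omega \psi_\epsilon'(\nabla u)\nabla v-\lambda^a_\rho(u)v+\lambda^b_\rho(u)v\,\mathrm dx=\int_\Omega gv\,\mathrm dx\qquad\text{for all }v\in H^1(\Omega).$$ Then $\lambda^a_\rho(u),\lambda^b_\rho(u)\in L^2(\Omega)$ and $$\|\lambda^a_\rho(u)\|_{L^2(\Omega)}+\|\lambda^b_\rho(u)\|_{L^2(\Omega)}\le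 2\|g\|_{L^2(\Omega)}.$$ -/

import Mathlib

open MeasureTheory TopologicalSpace
open scoped ENNReal Distributions

noncomputable section

namespace BVPenalty

/-- `ℝⁿ` with the Euclidean norm. -/
abbrev E (n : ℕ) : Type := EuclideanSpace ℝ (Fin n)

/-- `Du` is a weak gradient of `u` on `Ω`: both are locally integrable on `Ω` and
`∫_Ω u ∂ᵢφ dx = - ∫_Ω (Du)ᵢ φ dx` for all test functions `φ ∈ C_c^∞(Ω)` and all `i`. -/
structure IsWeakGradient {n : ℕ} (Ω : Opens (E n)) (u : E n → ℝ) (Du : E n → E n) : Prop where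
  locallyIntegrable : LocallyIntegrableOn u (Ω : Set (E n))
  locallyIntegrable_grad : LocallyIntegrableOn Du (Ω : Set (E n))
  integral_eq : ∀ (φ : 𝓓(Ω, ℝ)) (i : Fin n),
    ∫ x in (Ω : Set (E n)), u x * fderiv ℝ φ x (EuclideanSpace.single i 1) =
      - ∫ x in (Ω : Set (E n)), Du x i * φ x

/-- `u ∈ H¹(Ω)` with weak gradient `∇u = Du`: `u ∈ L²(Ω)`, `Du ∈ L²(Ω)ⁿ`, and `Du` is a weak
gradient of `u`. (The weak gradient is unique up to null sets.) -/
structure MemH1WithGradient {n : ℕ} (Ω : Opens (E n)) (u : E n → ℝ) (Du : E n → E n) :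
    Prop where
  memLp : MemLp u 2 (volume.restrict (Ω : Set (E n)))
  memLp_grad : MemLp Du 2 (volume.restrict (Ω : Set (E n)))
  isWeakGradient : IsWeakGradient Ω u Du

/-- The smoothing `ψ_ε(t) = √(ε + |t|²) + ε |t|²` of the Euclidean norm. -/
def psi {n : ℕ} (ε : ℝ) (t : E n) : ℝ := Real.sqrt (ε + ‖t‖ ^ 2) + ε * ‖t‖ ^ 2

open Classical in
/-- The smoothed positive part `max_ρ`. -/
def smoothMax (ρ x : ℝ) : ℝ :=
  if 1 / (2 * ρ) ≤ |x| then max 0 x else ρ / 2 * (x + 1 / (2 * ρ)) ^ 2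

/-- `λ^a_ρ(u) = max_ρ(ρ (u_a - u))`. -/
def lambdaA {n : ℕ} (ua ρ : ℝ) (u : E n → ℝ) (x : E n) : ℝ := smoothMax ρ (ρ * (ua - u x))

/-- `λ^b_ρ(u) = max_ρ(ρ (u - u_b))`. -/
def lambdaB {n : ℕ} (ub ρ : ℝ) (u : E n → ℝ) (x : E n) : ℝ := smoothMax ρ (ρ * (u x - ub))

/-- `u ∈ H¹(Ω)` solves the penalized smoothed equation with right-hand side `g`:
`∫_Ω ψ_ε'(∇u)∇v - λ^a_ρ(u) v + λ^b_ρ(u) v dx = ∫_Ω g v dx` for all `v ∈ H¹(Ω)`. -/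
def IsPenalizedSolution {n : ℕ} (Ω : Opens (E n)) (ua ub ε ρ : ℝ) (g u : E n → ℝ) : Prop :=
  ∃ Du : E n → E n, MemH1WithGradient Ω u Du ∧
    ∀ (v : E n → ℝ) (Dv : E n → E n), MemH1WithGradient Ω v Dv →
      ∫ x in (Ω : Set (E n)),
          (fderiv ℝ (psi ε) (Du x) (Dv x) - lambdaA ua ρ u x * v x + lambdaB ub ρ u x * v x) =
        ∫ x in (Ω : Set (E n)), g x * v x

end BVPenalty

end

/-! Test the equation with `v = f(u)`, where `f(u)` is either `-λ^a` or `λ^b`. Both choices of `f`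
are nondecreasing, so `∇v = f'(u)∇u` and the gradient term is nonnegative, `ψ_ε'(s)` being a
positive multiple of `⟨s, ·⟩`. The lower bound on `ρ²` forces `λ^a λ^b = 0`, so the penalty terms
reduce to `v²`. Hence `∫ v² ≤ ∫ g v`, which gives `‖v‖ ≤ ‖g‖`; adding the two bounds finishes. The
analytic work is the admissibility of `v`: the chain rule in `H¹` for a `C¹` function with bounded
derivative (`IsWeakGradient.integral_comp_mul_fderiv`), proved by mollification. -/

namespace BVPenalty
-- `L¹` convergence of mollifications
section Mollification
open Filter ContinuousLinearMap
open scoped Convolution Topology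

/-- A Scheffé-type argument: equality of the masses of `G i` and `|w|` replaces a fixed dominating
function. It is applied to `F = η * w` and `G = η * |w|`. -/
theorem tendsto_integral_norm_sub_of_le {α ι : Type*} [MeasurableSpace α] {μ : Measure α}
    {l : Filter ι} [l.IsCountablyGenerated] {F G : ι → α → ℝ} {w : α → ℝ}
    (hw : Integrable w μ) (hF : ∀ i, Integrable (F i) μ) (hG : ∀ i, Integrable (G i) μ)
    (hFG : ∀ i, ∀ᵐ x ∂μ, |F i x| ≤ G i x) (hGint : ∀ i, ∫ x, G i x ∂μ = ∫ x, |w x| ∂μ)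
    (hFlim : ∀ᵐ x ∂μ, Tendsto (fun i => F i x) l (𝓝 (w x)))
    (hGlim : ∀ᵐ x ∂μ, Tendsto (fun i => G i x) l (𝓝 |w x|)) :
    Tendsto (fun i => ∫ x, |F i x - w x| ∂μ) l (𝓝 0) := by
  have hmin : Tendsto (fun i => ∫ x, min |F i x - w x| (2 * |w x|) ∂μ) l (𝓝 0) := by
    have h := tendsto_integral_filter_of_dominated_convergence (μ := μ) (l := l)
      (F := fun i x => min |F i x - w x| (2 * |w x|)) (f := fun _ => (0 : ℝ))
      (fun x => 2 * |w x|)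
      (.of_forall fun i => ((hF i).sub hw).abs.aestronglyMeasurable.inf
        (hw.abs.const_mul 2).aestronglyMeasurable)
      (.of_forall fun i => .of_forall fun x => by
        rw [Real.norm_eq_abs, abs_of_nonneg (by positivity)]
        exact min_le_right _ _)
      (hw.abs.const_mul 2)
      (by
        filter_upwards [hFlim] with x hx
        have h1 : Tendsto (fun i => |F i x - w x|) l (𝓝 0) := by
          simpa using (hx.sub_const (w x)).abs
        simpa using h1.min (tendsto_const_nhds (x := 2 * |w x|)))
    simpa using h
  have hpos : Tendsto (fun i => ∫ x, max (|w x| - G i x) 0 ∂μ) l (𝓝 0) := by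
    have h := tendsto_integral_filter_of_dominated_convergence (μ := μ) (l := l)
      (F := fun i x => max (|w x| - G i x) 0) (f := fun _ => (0 : ℝ))
      (fun x => |w x|)
      (.of_forall fun i => (hw.abs.sub (hG i)).pos_part.aestronglyMeasurable)
      (.of_forall fun i => by
        filter_upwards [hFG i] with x hx
        rw [Real.norm_eq_abs, abs_of_nonneg (le_max_right _ _)]
        exact max_le (by linarith [(abs_nonneg (F i x)).trans hx]) (abs_nonneg _))
      hw.abs
      (by
        filter_upwards [hGlim] with x hx
        have h1 : Tendsto (fun i => |w x| - G i x) l (𝓝 0) := by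
          simpa using hx.const_sub (|w x|)
        simpa using h1.max (tendsto_const_nhds (x := (0 : ℝ))))
    simpa using h
  have hsum := hmin.add hpos
  rw [add_zero] at hsum
  refine squeeze_zero (fun i => integral_nonneg fun x => abs_nonneg _) (fun i => ?_) hsum
  have imin : Integrable (fun x => min |F i x - w x| (2 * |w x|)) μ :=
    ((hF i).sub hw).abs.inf (hw.abs.const_mul 2)
  have ipos : Integrable (fun x => max (|w x| - G i x) 0) μ := (hw.abs.sub (hG i)).pos_part
  have idiff : Integrable (fun x => G i x - |w x|) μ := (hG i).sub hw.abs
  have hzero : ∫ x, (G i x - |w x|) ∂μ = 0 := by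
    rw [integral_sub (hG i) hw.abs, hGint i, sub_self]
  -- Any excess of `|F - w|` over `2|w|` is at most `(G - |w|)⁺ = (|w| - G)⁺ + (G - |w|)`, and the
  -- last summand has zero integral.
  calc ∫ x, |F i x - w x| ∂μ
      ≤ ∫ x, (min |F i x - w x| (2 * |w x|) + max (|w x| - G i x) 0 + (G i x - |w x|)) ∂μ := by
        refine integral_mono_ae ((hF i).sub hw).abs ((imin.add ipos).add idiff) ?_
        filter_upwards [hFG i] with x hx
        have h1 : |F i x - w x| ≤ |F i x| + |w x| := abs_sub _ _
        rcases min_cases |F i x - w x| (2 * |w x|) with h | h <;>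
          rcases max_cases (|w x| - G i x) 0 with h' | h' <;> linarith
    _ = _ := by
        have h := integral_add (imin.add ipos) idiff
        simp only [Pi.add_apply] at h
        rw [h, integral_add imin ipos, hzero, add_zero]

variable {V : Type*} [NormedAddCommGroup V] [NormedSpace ℝ V] [FiniteDimensional ℝ V]
  [MeasurableSpace V] [BorelSpace V] {μ : Measure V} [μ.IsAddHaarMeasure]

theorem integrable_normed_convolution (η : ContDiffBump (0 : V)) {w : V → ℝ}
    (hw : Integrable w μ) : Integrable (η.normed μ ⋆[lsmul ℝ ℝ, μ] w) μ :=
  (η.integrable_normed).integrable_convolution _ hw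

theorem tendsto_integral_norm_normed_convolution_sub {ι : Type*} {l : Filter ι}
    [l.IsCountablyGenerated] {η : ι → ContDiffBump (0 : V)} {K : ℝ}
    (hη : Tendsto (fun i => (η i).rOut) l (𝓝 0)) (hK : ∀ᶠ i in l, (η i).rOut ≤ K * (η i).rIn)
    {w : V → ℝ} (hw : Integrable w μ) :
    Tendsto (fun i => ∫ x, |((η i).normed μ ⋆[lsmul ℝ ℝ, μ] w) x - w x| ∂μ) l (𝓝 0) :=
  tendsto_integral_norm_sub_of_le (G := fun i => (η i).normed μ ⋆[lsmul ℝ ℝ, μ] fun y => |w y|) hw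
    (fun i => integrable_normed_convolution _ hw)
    (fun i => integrable_normed_convolution _ hw.abs)
    (fun i => .of_forall fun x => by
      refine abs_integral_le_integral_abs.trans_eq (integral_congr_ae (.of_forall fun t => ?_))
      simp [abs_mul, abs_of_nonneg ((η i).nonneg_normed t)])
    (fun i => by
      rw [integral_convolution _ (η i).integrable_normed hw.abs]
      simp [(η i).integral_normed])
    (ContDiffBump.ae_convolution_tendsto_right_of_locallyIntegrable hη hK hw.locallyIntegrable)
    (ContDiffBump.ae_convolution_tendsto_right_of_locallyIntegrable hη hK hw.abs.locallyIntegrable)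

end Mollification
-- Chain rule for weak gradients
section ChainRule
open Filter ContinuousLinearMap
open scoped Convolution Topology

variable {n : ℕ} {Ω : Opens (E n)} {u : E n → ℝ} {Du : E n → E n}

/-- The derivative falls on the mollifier, and `y ↦ η(x - y)` is itself a test function on `Ω`
because the closed ball around `x` lies in `Ω`. -/
theorem IsWeakGradient.fderiv_normed_convolution_apply (h : IsWeakGradient Ω u Du)
    (hu : IntegrableOn u (Ω : Set (E n))) (η : ContDiffBump (0 : E n)) {x : E n}
    (hx : Metric.closedBall x η.rOut ⊆ Ω) (i : Fin n) :
    fderiv ℝ (η.normed volume ⋆[lsmul ℝ ℝ, volume] (Ω : Set (E n)).indicator u) x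
        (EuclideanSpace.single i 1) =
      (η.normed volume ⋆[lsmul ℝ ℝ, volume] (Ω : Set (E n)).indicator fun y => Du y i) x := by
  set e : E n := EuclideanSpace.single i 1
  set m : E n → ℝ := η.normed volume
  have hΩ : MeasurableSet (Ω : Set (E n)) := Ω.isOpen.measurableSet
  have hU : Integrable ((Ω : Set (E n)).indicator u) := (integrable_indicator_iff hΩ).2 hu
  have hm : ContDiff ℝ 1 m := η.contDiff_normed
  have hms : HasCompactSupport m := η.hasCompactSupport_normed
  have hθ : ContDiff ℝ ((⊤ : ℕ∞) : WithTop ℕ∞) fun y => m (x - y) :=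
    η.contDiff_normed.comp (contDiff_const.sub contDiff_id)
  have hθsupp : tsupport (fun y => m (x - y)) ⊆ Metric.closedBall x η.rOut := by
    refine closure_minimal (fun y hy => ?_) Metric.isClosed_closedBall
    have hy' : x - y ∈ Function.support m := hy
    rw [η.support_normed_eq, mem_ball_zero_iff] at hy'
    rw [Metric.mem_closedBall, dist_comm, dist_eq_norm]
    exact hy'.le
  let θ : 𝓓(Ω, ℝ) := ⟨fun y => m (x - y), hθ,
    HasCompactSupport.of_support_subset_isCompact (isCompact_closedBall x η.rOut)
      (subset_closure.trans hθsupp), hθsupp.trans hx⟩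
  have hθd : ∀ y, fderiv ℝ θ y e = -fderiv ℝ m (x - y) e := fun y => by
    have h1 : HasFDerivAt (fun z => x - z) (-ContinuousLinearMap.id ℝ (E n)) y :=
      (hasFDerivAt_id y).const_sub x
    have h2 := ((hm.differentiable one_ne_zero (x - y)).hasFDerivAt).comp y h1
    have h3 : fderiv ℝ θ y = _ := h2.fderiv
    rw [h3]
    simp
  have hex := (hms.fderiv (𝕜 := ℝ)).convolutionExists_left ((lsmul ℝ ℝ).precompL (E n))
    (hm.continuous_fderiv one_ne_zero) hU.locallyIntegrable x
  rw [(hms.hasFDerivAt_convolution_left (lsmul ℝ ℝ) hm hU.locallyIntegrable x).fderiv]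
  rw [convolution, ContinuousLinearMap.integral_apply hex, ← integral_sub_left_eq_self _ _ x,
    convolution_eq_swap]
  have hw := h.integral_eq θ i
  have h1 : ∫ y, ((lsmul ℝ ℝ).precompL (E n) (fderiv ℝ m (x - y))
      ((Ω : Set (E n)).indicator u (x - (x - y)))) e =
      -∫ y in (Ω : Set (E n)), u y * fderiv ℝ θ y e := by
    rw [← integral_indicator hΩ, ← integral_neg]
    refine integral_congr_ae (.of_forall fun y => ?_)
    by_cases hy : y ∈ (Ω : Set (E n))
    · simp [hy, hθd, mul_comm, precompL_apply]
    · simp [hy]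
  have h2 : ∫ y, (lsmul ℝ ℝ (m (x - y))) ((Ω : Set (E n)).indicator (fun y => Du y i) y) =
      ∫ y in (Ω : Set (E n)), Du y i * θ y := by
    rw [← integral_indicator hΩ]
    refine integral_congr_ae (.of_forall fun y => ?_)
    by_cases hy : y ∈ (Ω : Set (E n))
    · simp only [hy, Set.indicator_of_mem, lsmul_apply, smul_eq_mul]
      exact mul_comm _ _
    · simp [hy]
  rw [h1, h2, hw, neg_neg]

theorem abs_sub_le_of_hasDerivAt_of_abs_le {f f' : ℝ → ℝ} {L : ℝ}
    (hf : ∀ s, HasDerivAt f (f' s) s) (hL : ∀ s, |f' s| ≤ L) (s t : ℝ) :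
    |f s - f t| ≤ L * |s - t| := by
  simpa using Convex.norm_image_sub_le_of_norm_hasDerivWithin_le (s := Set.univ)
    (fun z _ => (hf z).hasDerivWithinAt) (fun z _ => hL z) convex_univ
    (Set.mem_univ t) (Set.mem_univ s)

theorem tendsto_integral_comp_mul {α : Type*} [MeasurableSpace α] {μ : Measure α}
    {f f' : ℝ → ℝ} {L C : ℝ} (hf : ∀ s, HasDerivAt f (f' s) s) (hL : ∀ s, |f' s| ≤ L)
    {U : ℕ → α → ℝ} {U₀ ζ : α → ℝ} (hU : ∀ k, Integrable (U k) μ) (hU₀ : Integrable U₀ μ)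
    (hlim : Tendsto (fun k => ∫ x, |U k x - U₀ x| ∂μ) atTop (𝓝 0))
    (hζ : Integrable ζ μ) (hC : ∀ x, |ζ x| ≤ C) :
    Tendsto (fun k => ∫ x, f (U k x) * ζ x ∂μ) atTop (𝓝 (∫ x, f (U₀ x) * ζ x ∂μ)) := by
  have hlip := abs_sub_le_of_hasDerivAt_of_abs_le hf hL
  have hcont : Continuous f := continuous_iff_continuousAt.2 fun s => (hf s).continuousAt
  have hL0 : 0 ≤ L := (abs_nonneg _).trans (hL 0)
  have hint : ∀ V : α → ℝ, Integrable V μ → Integrable (fun x => f (V x) * ζ x) μ := by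
    intro V hV
    refine ((hζ.abs.const_mul |f 0|).add (hV.abs.const_mul (L * C))).mono'
      ((hcont.comp_aestronglyMeasurable hV.aestronglyMeasurable).mul hζ.aestronglyMeasurable)
      (.of_forall fun x => ?_)
    have h1 : |f (V x)| ≤ |f 0| + L * |V x| := by
      have := hlip (V x) 0
      rw [sub_zero] at this
      linarith [abs_sub_abs_le_abs_sub (f (V x)) (f 0)]
    rw [Real.norm_eq_abs, abs_mul]
    have h2 := mul_le_mul_of_nonneg_right h1 (abs_nonneg (ζ x))
    have h3 := mul_le_mul_of_nonneg_left (hC x) (mul_nonneg hL0 (abs_nonneg (V x)))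
    simp only [Pi.add_apply]
    linarith
  rw [tendsto_iff_norm_sub_tendsto_zero]
  refine squeeze_zero (fun _ => norm_nonneg _) (fun k => ?_)
    (by simpa using hlim.const_mul (L * C))
  rw [← integral_sub (hint _ (hU k)) (hint _ hU₀), ← integral_const_mul]
  refine norm_integral_le_of_norm_le (((hU k).sub hU₀).abs.const_mul (L * C))
    (.of_forall fun x => ?_)
  rw [← sub_mul, Real.norm_eq_abs, abs_mul]
  have h2 := mul_le_mul (hlip (U k x) (U₀ x)) (hC x) (abs_nonneg _)
    (mul_nonneg hL0 (abs_nonneg _))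
  linarith

theorem tendsto_integral_comp_mul_mul {α : Type*} [MeasurableSpace α] {μ : Measure α}
    {f' : ℝ → ℝ} {L C : ℝ} (hf' : Continuous f') (hL : ∀ s, |f' s| ≤ L)
    {U W : ℕ → α → ℝ} {U₀ W₀ φ : α → ℝ} (hU : ∀ k, AEStronglyMeasurable (U k) μ)
    (hW : ∀ k, Integrable (W k) μ) (hW₀ : Integrable W₀ μ)
    (hUlim : ∀ᵐ x ∂μ, Tendsto (fun k => U k x) atTop (𝓝 (U₀ x)))
    (hWlim : Tendsto (fun k => ∫ x, |W k x - W₀ x| ∂μ) atTop (𝓝 0))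
    (hφ : AEStronglyMeasurable φ μ) (hC : ∀ x, |φ x| ≤ C) :
    Tendsto (fun k => ∫ x, f' (U k x) * W k x * φ x ∂μ) atTop
      (𝓝 (∫ x, f' (U₀ x) * W₀ x * φ x ∂μ)) := by
  have hL0 : 0 ≤ L := (abs_nonneg _).trans (hL 0)
  have hbd : ∀ (s w : ℝ) (x : α), |f' s * w * φ x| ≤ L * C * |w| := fun s w x => by
    rw [abs_mul, abs_mul]
    have h1 := mul_le_mul (hL s) (hC x) (abs_nonneg _) hL0
    have h2 := mul_le_mul_of_nonneg_right h1 (abs_nonneg w)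
    linarith
  have hint : ∀ V w : α → ℝ, AEStronglyMeasurable V μ → Integrable w μ →
      Integrable (fun x => f' (V x) * w x * φ x) μ := fun V w hV hw =>
    (hw.abs.const_mul (L * C)).mono'
      (((hf'.comp_aestronglyMeasurable hV).mul hw.aestronglyMeasurable).mul hφ)
      (.of_forall fun x => hbd _ _ _)
  -- Split `W k = (W k - W₀) + W₀`: the first part tends to zero by `L¹` convergence, the second
  -- converges by domination.
  have hfirst : Tendsto (fun k => ∫ x, f' (U k x) * (W k x - W₀ x) * φ x ∂μ) atTop (𝓝 0) := by
    refine squeeze_zero_norm (fun k => ?_) (by simpa using hWlim.const_mul (L * C))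
    rw [← integral_const_mul]
    exact norm_integral_le_of_norm_le (((hW k).sub hW₀).abs.const_mul (L * C))
      (.of_forall fun x => hbd _ _ _)
  have hsecond : Tendsto (fun k => ∫ x, f' (U k x) * W₀ x * φ x ∂μ) atTop
      (𝓝 (∫ x, f' (U₀ x) * W₀ x * φ x ∂μ)) := by
    refine tendsto_integral_of_dominated_convergence (fun x => L * C * |W₀ x|)
      (fun k => (hint _ _ (hU k) hW₀).aestronglyMeasurable) (hW₀.abs.const_mul (L * C))
      (fun k => .of_forall fun x => hbd _ _ _) ?_
    filter_upwards [hUlim] with x hx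
    exact (((hf'.tendsto _).comp hx).mul_const _).mul_const _
  have hsum := hfirst.add hsecond
  rw [zero_add] at hsum
  refine hsum.congr fun k => ?_
  have h := integral_add (hint _ _ (hU k) ((hW k).sub hW₀)) (hint _ _ (hU k) hW₀)
  refine h.symm.trans (integral_congr_ae (.of_forall fun x => ?_))
  simp only [Pi.sub_apply]
  ring

theorem IsWeakGradient.integral_comp_mul_fderiv (h : IsWeakGradient Ω u Du)
    (hu : IntegrableOn u (Ω : Set (E n))) (hDu : IntegrableOn Du (Ω : Set (E n)))
    {f f' : ℝ → ℝ} {L : ℝ} (hf : ∀ s, HasDerivAt f (f' s) s) (hf' : Continuous f')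
    (hL : ∀ s, |f' s| ≤ L) (φ : 𝓓(Ω, ℝ)) (i : Fin n) :
    ∫ x in (Ω : Set (E n)), f (u x) * fderiv ℝ φ x (EuclideanSpace.single i 1) =
      -∫ x in (Ω : Set (E n)), f' (u x) * Du x i * φ x := by
  set e : E n := EuclideanSpace.single i 1
  have hΩ : MeasurableSet (Ω : Set (E n)) := Ω.isOpen.measurableSet
  -- Mollifying at radius at most `δ` keeps every ball centred in the support of `φ` inside `Ω`.
  obtain ⟨δ, hδ, hδΩ⟩ := φ.hasCompactSupport.exists_cthickening_subset_open Ω.isOpen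
    φ.tsupport_subset
  set U := (Ω : Set (E n)).indicator u
  set W := (Ω : Set (E n)).indicator fun y => Du y i
  have hU : Integrable U := (integrable_indicator_iff hΩ).2 hu
  have hW : Integrable W := (integrable_indicator_iff hΩ).2
    ((EuclideanSpace.proj i : E n →L[ℝ] ℝ).integrable_comp hDu)
  -- The fixed ratio of outer to inner radius is what a.e. convergence of the mollifications needs.
  let η : ℕ → ContDiffBump (0 : E n) := fun k =>
    ⟨δ / (k + 1) / 2, δ / (k + 1), by positivity, half_lt_self (by positivity)⟩
  have hη : Tendsto (fun k => (η k).rOut) atTop (𝓝 0) := by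
    simpa [η, div_eq_mul_inv] using
      (tendsto_one_div_add_atTop_nhds_zero_nat (𝕜 := ℝ)).const_mul δ
  have hηδ : ∀ k, (η k).rOut ≤ δ := fun k =>
    div_le_self hδ.le (by linarith [Nat.cast_nonneg (α := ℝ) k])
  have hηK : ∀ᶠ k in atTop, (η k).rOut ≤ 2 * (η k).rIn :=
    .of_forall fun k => by simp only [η]; linarith
  set Um := fun k => (η k).normed volume ⋆[lsmul ℝ ℝ, volume] U
  set Wm := fun k => (η k).normed volume ⋆[lsmul ℝ ℝ, volume] W
  have hUmC : ∀ k, ContDiff ℝ 1 (Um k) := fun k =>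
    (η k).hasCompactSupport_normed.contDiff_convolution_left _ (η k).contDiff_normed
      hU.locallyIntegrable
  have hfc : ContDiff ℝ 1 f := by
    rw [contDiff_one_iff_deriv]
    refine ⟨fun s => (hf s).differentiableAt, ?_⟩
    rwa [show deriv f = f' from funext fun s => (hf s).deriv]
  have hφC : ContDiff ℝ 1 φ := φ.contDiff.of_le (by exact_mod_cast le_top)
  have hφd : Continuous fun x => fderiv ℝ φ x e :=
    (hφC.continuous_fderiv one_ne_zero).clm_apply continuous_const
  have hφds : HasCompactSupport fun x => fderiv ℝ φ x e :=
    φ.hasCompactSupport.fderiv_apply (𝕜 := ℝ) e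
  have hparts : ∀ k, ∫ x, f (Um k x) * fderiv ℝ φ x e =
      -∫ x, f' (Um k x) * Wm k x * φ x := by
    intro k
    have hc : ContDiff ℝ 1 fun x => f (Um k x) := hfc.comp (hUmC k)
    have hcd : Continuous fun x => fderiv ℝ (fun y => f (Um k y)) x e :=
      (hc.continuous_fderiv one_ne_zero).clm_apply continuous_const
    rw [integral_mul_fderiv_eq_neg_fderiv_mul_of_integrable
      ((hcd.mul φ.continuous).integrable_of_hasCompactSupport φ.hasCompactSupport.mul_left)
      ((hc.continuous.mul hφd).integrable_of_hasCompactSupport hφds.mul_left)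
      ((hc.continuous.mul φ.continuous).integrable_of_hasCompactSupport
        φ.hasCompactSupport.mul_left)
      (fun x _ => hc.differentiable one_ne_zero x)
      (fun x _ => hφC.differentiable one_ne_zero x)]
    congr 1
    refine integral_congr_ae (.of_forall fun x => ?_)
    -- The mollified gradient is identified only near `Ω`'s interior points carrying `φ`; elsewhere
    -- both integrands vanish.
    by_cases hx : x ∈ tsupport φ
    · have h1 : HasFDerivAt (fun y => f (Um k y)) (f' (Um k x) • fderiv ℝ (Um k) x) x :=
        (hf (Um k x)).comp_hasFDerivAt x ((hUmC k).differentiable one_ne_zero x).hasFDerivAt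
      have h2 : fderiv ℝ (Um k) x e = Wm k x :=
        h.fderiv_normed_convolution_apply hu (η k) (((Metric.closedBall_subset_closedBall
          (hηδ k)).trans (Metric.closedBall_subset_cthickening hx δ)).trans hδΩ) i
      simp only [h1.fderiv, smul_apply, h2, smul_eq_mul]
    · simp [image_eq_zero_of_notMem_tsupport hx]
  obtain ⟨C₁, hC₁⟩ := hφd.bounded_above_of_compact_support hφds
  obtain ⟨C₂, hC₂⟩ := φ.continuous.bounded_above_of_compact_support φ.hasCompactSupport
  have hleft := tendsto_integral_comp_mul hf hL
    (fun k => integrable_normed_convolution (η k) hU) hU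
    (tendsto_integral_norm_normed_convolution_sub hη hηK hU)
    (hφd.integrable_of_hasCompactSupport hφds) hC₁
  have hright := tendsto_integral_comp_mul_mul hf' hL
    (fun k => (integrable_normed_convolution (η k) hU).aestronglyMeasurable)
    (fun k => integrable_normed_convolution (η k) hW) hW
    (ContDiffBump.ae_convolution_tendsto_right_of_locallyIntegrable hη hηK hU.locallyIntegrable)
    (tendsto_integral_norm_normed_convolution_sub hη hηK hW)
    φ.continuous.aestronglyMeasurable hC₂
  have heq := tendsto_nhds_unique hleft (hright.neg.congr fun k => (hparts k).symm)
  have hoff : ∀ x ∉ (Ω : Set (E n)), x ∉ tsupport φ := fun x hx hx' => hx (φ.tsupport_subset hx')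
  have hl : ∫ x in (Ω : Set (E n)), f (u x) * fderiv ℝ φ x e = ∫ x, f (U x) * fderiv ℝ φ x e := by
    rw [← setIntegral_eq_integral_of_forall_compl_eq_zero (μ := volume)
        (s := (Ω : Set (E n))) fun x hx => by
      rw [image_eq_zero_of_notMem_tsupport (fun hx' => hoff x hx (tsupport_fderiv_subset ℝ hx'))]
      simp]
    exact setIntegral_congr_fun hΩ fun x hx => by simp only [U, Set.indicator_of_mem hx]
  have hr : ∫ x in (Ω : Set (E n)), f' (u x) * Du x i * φ x = ∫ x, f' (U x) * W x * φ x := by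
    rw [← setIntegral_eq_integral_of_forall_compl_eq_zero (μ := volume)
        (s := (Ω : Set (E n))) fun x hx => by
      rw [image_eq_zero_of_notMem_tsupport (hoff x hx), mul_zero]]
    exact setIntegral_congr_fun hΩ fun x hx => by simp only [U, W, Set.indicator_of_mem hx]
  rw [hl, hr, heq]

end ChainRule
-- Composition in `H¹` and the derivative of `ψ_ε`
section Structure
open Filter

variable {n : ℕ}

theorem MemH1WithGradient.comp {Ω : Opens (E n)} {u : E n → ℝ} {Du : E n → E n}
    [IsFiniteMeasure (volume.restrict (Ω : Set (E n)))] (h : MemH1WithGradient Ω u Du)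
    {f f' : ℝ → ℝ} {L : ℝ} (hf : ∀ s, HasDerivAt f (f' s) s) (hf' : Continuous f')
    (hL : ∀ s, |f' s| ≤ L) :
    MemH1WithGradient Ω (fun x => f (u x)) (fun x => f' (u x) • Du x) := by
  have hL0 : 0 ≤ L := (abs_nonneg _).trans (hL 0)
  have hcont : Continuous f := continuous_iff_continuousAt.2 fun s => (hf s).continuousAt
  have hm : MemLp (fun x => f (u x)) 2 (volume.restrict (Ω : Set (E n))) := by
    have hbound : MemLp (fun x => |f 0| + L * |u x|) 2 (volume.restrict (Ω : Set (E n))) :=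
      (memLp_const |f 0|).add (g := fun x => L * |u x|) (h.memLp.abs.const_mul L)
    refine hbound.mono' (hcont.comp_aestronglyMeasurable h.memLp.aestronglyMeasurable)
      (.of_forall fun x => ?_)
    have := abs_sub_le_of_hasDerivAt_of_abs_le hf hL (u x) 0
    rw [sub_zero] at this
    rw [Real.norm_eq_abs]
    linarith [abs_sub_abs_le_abs_sub (f (u x)) (f 0)]
  have hmD : MemLp (fun x => f' (u x) • Du x) 2 (volume.restrict (Ω : Set (E n))) := by
    refine (h.memLp_grad.norm.const_mul L).mono'
      ((hf'.comp_aestronglyMeasurable h.memLp.aestronglyMeasurable).smul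
        h.memLp_grad.aestronglyMeasurable) (.of_forall fun x => ?_)
    rw [norm_smul]
    exact mul_le_mul_of_nonneg_right (hL _) (norm_nonneg _)
  refine ⟨hm, hmD, IntegrableOn.locallyIntegrableOn (hm.integrable one_le_two),
    IntegrableOn.locallyIntegrableOn (hmD.integrable one_le_two), fun φ i => ?_⟩
  simpa using h.isWeakGradient.integral_comp_mul_fderiv (h.memLp.integrable one_le_two)
    (h.memLp_grad.integrable one_le_two) hf hf' hL φ i

theorem fderiv_psi_apply {ε : ℝ} (hε : 0 < ε) (s t : E n) :
    fderiv ℝ (psi ε) s t = ((Real.sqrt (ε + ‖s‖ ^ 2))⁻¹ + 2 * ε) * inner ℝ s t := by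
  have hpos : 0 < ε + ‖s‖ ^ 2 := by positivity
  have h1 : HasFDerivAt (fun y : E n => ‖y‖ ^ 2) (2 • innerSL ℝ s) s :=
    (hasStrictFDerivAt_norm_sq s).hasFDerivAt
  have h2 := ((h1.const_add ε).sqrt hpos.ne').add (h1.const_mul ε)
  have h3 : fderiv ℝ (psi ε) s = _ := h2.fderiv
  rw [h3]
  simp only [add_apply, smul_apply, innerSL_apply_apply, nsmul_eq_mul, smul_eq_mul]
  have : Real.sqrt (ε + ‖s‖ ^ 2) ≠ 0 := (Real.sqrt_pos.2 hpos).ne'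
  field_simp
  push_cast
  ring

theorem integrable_fderiv_psi_apply {α : Type*} [MeasurableSpace α] {μ : Measure α} {ε : ℝ}
    (hε : 0 < ε) {D D' : α → E n} (hD : MemLp D 2 μ) (hD' : MemLp D' 2 μ) :
    Integrable (fun x => fderiv ℝ (psi ε) (D x) (D' x)) μ := by
  simp only [fderiv_psi_apply hε]
  have hc : Continuous fun s : E n => (Real.sqrt (ε + ‖s‖ ^ 2))⁻¹ + 2 * ε := by
    refine Continuous.add (Continuous.inv₀ (by fun_prop) fun s => ?_) continuous_const
    have : 0 < ε + ‖s‖ ^ 2 := by positivity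
    exact (Real.sqrt_pos.2 this).ne'
  refine ((hD.norm.integrable_mul hD'.norm).const_mul ((Real.sqrt ε)⁻¹ + 2 * ε)).mono'
    ((hc.comp_aestronglyMeasurable hD.aestronglyMeasurable).mul
      (hD.aestronglyMeasurable.inner hD'.aestronglyMeasurable)) (.of_forall fun x => ?_)
  have h1 : Real.sqrt ε ≤ Real.sqrt (ε + ‖D x‖ ^ 2) :=
    Real.sqrt_le_sqrt (by linarith [sq_nonneg ‖D x‖])
  have h2 : 0 < Real.sqrt ε := Real.sqrt_pos.2 hε
  rw [norm_mul, Real.norm_of_nonneg (by positivity)]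
  simp only [Pi.mul_apply]
  gcongr
  exact norm_inner_le_norm _ _

/-! ### The smoothed positive part and disjointness of the penalties -/

theorem hasDerivAt_max_zero_sq (x : ℝ) :
    HasDerivAt (fun y : ℝ => max 0 y ^ 2) (2 * max 0 x) x := by
  rw [hasDerivAt_iff_isLittleO]
  refine Asymptotics.IsBigO.trans_isLittleO (g := fun y => (y - x) ^ 2)
    (Asymptotics.IsBigO.of_bound 1 (.of_forall fun y => ?_)) ?_
  · rw [Real.norm_eq_abs, Real.norm_eq_abs, abs_of_nonneg (sq_nonneg (y - x)), one_mul, smul_eq_mul,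
      abs_le]
    rcases max_cases 0 y with h | h <;> rcases max_cases 0 x with h' | h' <;>
      rw [h.1, h'.1] <;> constructor <;> nlinarith [sq_nonneg (y - x), sq_nonneg (y + x)]
  · have h : Tendsto (fun y : ℝ => y - x) (nhds x) (nhds 0) := by
      simpa using (continuous_sub_right x).tendsto x
    simpa [Function.comp_def] using (Asymptotics.isLittleO_pow_id one_lt_two).comp_tendsto h

/-- This form without case distinction on `|x|` makes the `C¹` regularity immediate. -/
theorem smoothMax_eq {ρ : ℝ} (hρ : 0 < ρ) (x : ℝ) :
    smoothMax ρ x =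
      ρ / 2 * (max 0 (x + 1 / (2 * ρ)) ^ 2 - max 0 (x - 1 / (2 * ρ)) ^ 2) := by
  have hh : 0 < 1 / (2 * ρ) := by positivity
  have hρh : ρ * (1 / (2 * ρ)) = 1 / 2 := by field_simp
  unfold smoothMax
  generalize 1 / (2 * ρ) = h at *
  split_ifs with hx
  · rcases le_abs'.1 hx with hx | hx
    · rw [max_eq_left (by linarith), max_eq_left (by linarith), max_eq_left (by linarith)]
      ring
    · rw [max_eq_right (by linarith), max_eq_right (by linarith), max_eq_right (by linarith)]
      linear_combination -2 * x * hρh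
  · rw [not_le, abs_lt] at hx
    rw [max_eq_right (by linarith), max_eq_left (by linarith)]
    ring

theorem smoothMax_eq_zero {ρ x : ℝ} (hρ : 0 < ρ) (hx : x ≤ -(1 / (2 * ρ))) :
    smoothMax ρ x = 0 := by
  have hh : 0 < 1 / (2 * ρ) := by positivity
  rw [smoothMax_eq hρ, max_eq_left (by linarith), max_eq_left (by linarith)]
  ring

theorem exists_hasDerivAt_smoothMax {ρ : ℝ} (hρ : 0 < ρ) :
    ∃ m : ℝ → ℝ, (∀ x, HasDerivAt (smoothMax ρ) (m x) x) ∧ Continuous m ∧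
      ∀ x, 0 ≤ m x ∧ m x ≤ 1 := by
  have hh : 0 < 1 / (2 * ρ) := by positivity
  have hρh : ρ * (1 / (2 * ρ)) = 1 / 2 := by field_simp
  rw [show smoothMax ρ = _ from funext (smoothMax_eq hρ)]
  generalize 1 / (2 * ρ) = h at *
  refine ⟨fun x => ρ * (max 0 (x + h) - max 0 (x - h)), fun x => ?_, by fun_prop, fun x => ?_⟩
  · have h1 := (hasDerivAt_max_zero_sq (x + h)).comp_add_const x h
    have h2 := (hasDerivAt_max_zero_sq (x - h)).comp_sub_const x h
    exact ((h1.sub h2).const_mul (ρ / 2)).congr_deriv (by ring)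
  · rcases max_cases 0 (x + h) with h1 | h1 <;> rcases max_cases 0 (x - h) with h2 | h2 <;>
      simp only [h1.1, h2.1] <;> constructor <;> nlinarith

/-- The two arguments of `smoothMax` sum to `-ρ(ub - ua) ≤ -1/ρ`, so at least one is `≤ -1/(2ρ)`,
where `smoothMax` vanishes. -/
theorem lambdaA_mul_lambdaB {ua ub ρ : ℝ} (hab : ua < ub) (hρ : 0 < ρ)
    (hρab : 1 / (ub - ua) ≤ ρ ^ 2) (u : E n → ℝ) (x : E n) :
    lambdaA ua ρ u x * lambdaB ub ρ u x = 0 := by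
  have hab' : 0 < ub - ua := sub_pos.2 hab
  have h1 : 1 ≤ ρ ^ 2 * (ub - ua) := (div_le_iff₀ hab').1 hρab
  have h2 : 2 * (1 / (2 * ρ)) ≤ ρ * (ub - ua) := by
    rw [show 2 * (1 / (2 * ρ)) = 1 / ρ by field_simp, div_le_iff₀ hρ]
    linarith
  rcases le_total (ρ * (ua - u x)) (-(1 / (2 * ρ))) with h | h
  · rw [lambdaA, smoothMax_eq_zero hρ h, zero_mul]
  · rw [lambdaB, smoothMax_eq_zero (x := ρ * (u x - ub)) hρ (by linarith), mul_zero]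

/-! ### Energy estimate -/

theorem eLpNorm_two_le_of_integral_sq_le {α : Type*} [MeasurableSpace α] {μ : Measure α}
    {X g : α → ℝ} (hX : MemLp X 2 μ) (hg : MemLp g 2 μ)
    (h : ∫ x, X x ^ 2 ∂μ ≤ ∫ x, g x * X x ∂μ) : eLpNorm X 2 μ ≤ eLpNorm g 2 μ := by
  have hle : ∫ x, X x ^ 2 ∂μ ≤ ∫ x, g x ^ 2 ∂μ := by
    -- Young's inequality; half of `∫ X²` is then absorbed on the left.
    have h1 : ∫ x, g x * X x ∂μ ≤ ∫ x, (1 / 2 * g x ^ 2 + 1 / 2 * X x ^ 2) ∂μ :=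
      integral_mono (hg.integrable_mul hX)
        ((hg.integrable_sq.const_mul _).add (hX.integrable_sq.const_mul _))
        fun x => by
          have := sq_nonneg (g x - X x)
          simp only
          linarith
    rw [integral_add (hg.integrable_sq.const_mul _) (hX.integrable_sq.const_mul _),
      integral_const_mul, integral_const_mul] at h1
    linarith
  rw [hX.eLpNorm_eq_integral_rpow_norm two_ne_zero ENNReal.ofNat_ne_top,
    hg.eLpNorm_eq_integral_rpow_norm two_ne_zero ENNReal.ofNat_ne_top]
  simp only [ENNReal.toReal_ofNat, Real.rpow_ofNat, Real.norm_eq_abs, sq_abs]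
  exact ENNReal.ofReal_le_ofReal (Real.rpow_le_rpow
    (integral_nonneg fun _ => sq_nonneg _) hle (by norm_num))

/-- Treats both penalties at once: `hsq` encodes their disjointness, and `hnonneg` makes the
gradient term droppable. -/
theorem IsPenalizedSolution.memLp_comp_and_eLpNorm_le {Ω : Opens (E n)} {ua ub ε ρ : ℝ}
    {g u : E n → ℝ} [IsFiniteMeasure (volume.restrict (Ω : Set (E n)))]
    (hu : IsPenalizedSolution Ω ua ub ε ρ g u) (hε : 0 < ε)
    (hg : MemLp g 2 (volume.restrict (Ω : Set (E n))))
    {f f' : ℝ → ℝ} {L : ℝ} (hf : ∀ s, HasDerivAt f (f' s) s) (hf' : Continuous f')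
    (hnonneg : ∀ s, 0 ≤ f' s) (hL : ∀ s, f' s ≤ L)
    (hsq : ∀ x, -lambdaA ua ρ u x * f (u x) + lambdaB ub ρ u x * f (u x) = f (u x) ^ 2) :
    MemLp (fun x => f (u x)) 2 (volume.restrict (Ω : Set (E n))) ∧
      eLpNorm (fun x => f (u x)) 2 (volume.restrict (Ω : Set (E n))) ≤
        eLpNorm g 2 (volume.restrict (Ω : Set (E n))) := by
  obtain ⟨Du, hDu, heq⟩ := hu
  have hv := hDu.comp hf hf' fun s => (abs_of_nonneg (hnonneg s)).trans_le (hL s)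
  refine ⟨hv.memLp, eLpNorm_two_le_of_integral_sq_le hv.memLp hg ?_⟩
  rw [← heq _ _ hv]
  refine integral_mono hv.memLp.integrable_sq
    (((integrable_fderiv_psi_apply hε hDu.memLp_grad hv.memLp_grad).add
      hv.memLp.integrable_sq).congr (.of_forall fun x => ?_)) fun x => ?_
  · simp only [Pi.add_apply, ← hsq x]
    ring
  · have h1 : 0 ≤ fderiv ℝ (psi ε) (Du x) (f' (u x) • Du x) := by
      rw [fderiv_psi_apply hε, real_inner_smul_right, real_inner_self_eq_norm_sq]
      have := hnonneg (u x)
      positivity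
    have h2 := hsq x
    simp only
    linarith

end Structure
end BVPenalty

theorem lemma3p3 {n : ℕ} (Ω : Opens (BVPenalty.E n))
    (hΩ : Bornology.IsBounded (Ω : Set (BVPenalty.E n)))
    (ua ub ε ρ : ℝ) (hab : ua < ub) (hε : 0 < ε) (hρ : 0 < ρ) (hρab : 1 / (ub - ua) ≤ ρ ^ 2)
    (g u : BVPenalty.E n → ℝ)
    (hg : MemLp g 2 (volume.restrict (Ω : Set (BVPenalty.E n))))
    (hu : BVPenalty.IsPenalizedSolution Ω ua ub ε ρ g u) :
    MemLp (BVPenalty.lambdaA ua ρ u) 2 (volume.restrict (Ω : Set (BVPenalty.E n))) ∧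
    MemLp (BVPenalty.lambdaB ub ρ u) 2 (volume.restrict (Ω : Set (BVPenalty.E n))) ∧
    eLpNorm (BVPenalty.lambdaA ua ρ u) 2 (volume.restrict (Ω : Set (BVPenalty.E n))) +
        eLpNorm (BVPenalty.lambdaB ub ρ u) 2 (volume.restrict (Ω : Set (BVPenalty.E n))) ≤
      2 * eLpNorm g 2 (volume.restrict (Ω : Set (BVPenalty.E n))) := by
  have : IsFiniteMeasure (volume.restrict (Ω : Set (BVPenalty.E n))) :=
    isFiniteMeasure_restrict.2 hΩ.measure_lt_top.ne
  obtain ⟨m, hm, hmc, hm01⟩ := BVPenalty.exists_hasDerivAt_smoothMax hρ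
  have hdisj := BVPenalty.lambdaA_mul_lambdaB hab hρ hρab u
  -- The minus sign makes `f` nondecreasing and matches the sign of `λ^a` in the equation.
  have hA := hu.memLp_comp_and_eLpNorm_le hε hg (L := ρ)
    (f := fun s => -BVPenalty.smoothMax ρ (ρ * (ua - s))) (f' := fun s => ρ * m (ρ * (ua - s)))
    (fun s => by
      have h := ((hm (ρ * (ua - s))).comp s (((hasDerivAt_id s).const_sub ua).const_mul ρ)).neg
      exact h.congr_deriv (by ring))
    (by fun_prop) (fun s => mul_nonneg hρ.le (hm01 _).1)
    (fun s => mul_le_of_le_one_right hρ.le (hm01 _).2)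
    (fun x => by
      have h := hdisj x
      rw [BVPenalty.lambdaA] at h ⊢
      linear_combination -h)
  have hB := hu.memLp_comp_and_eLpNorm_le hε hg (L := ρ)
    (f := fun s => BVPenalty.smoothMax ρ (ρ * (s - ub))) (f' := fun s => ρ * m (ρ * (s - ub)))
    (fun s => by
      have h := (hm (ρ * (s - ub))).comp s (((hasDerivAt_id s).sub_const ub).const_mul ρ)
      exact h.congr_deriv (by ring))
    (by fun_prop) (fun s => mul_nonneg hρ.le (hm01 _).1)
    (fun s => mul_le_of_le_one_right hρ.le (hm01 _).2)
    (fun x => by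
      have h := hdisj x
      rw [BVPenalty.lambdaB] at h ⊢
      linear_combination -h)
  have hAneg : (fun x => -BVPenalty.smoothMax ρ (ρ * (ua - u x))) = -BVPenalty.lambdaA ua ρ u := rfl
  simp only [hAneg, eLpNorm_neg, memLp_neg_iff] at hA
  refine ⟨hA.1, hB.1, ?_⟩
  rw [two_mul]
  exact add_le_add hA.2 hB.2
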